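/- Let $\theta$ be an irrational real number and $\lambda=e^{2\pi i\theta}$. Let $\mathcal{O}(\mathbb{T}^2_\theta)$ be the coordinate algebra of the noncommutative torus, that is, the unital complex $*$-algebra generated by $U,V$ subject to the relations $UU^*=U^*U=1$, $VV^*=V^*V=1$ and $UV=\lambda VU$, and let $\sigma$ be the involutive algebra automorphism of $\mathcal{O}(\mathbb{T}^2_\theta)$ with $\sigma(U)=U^*$ and $\sigma(V)=V^*$. For $i\in\mathbb{Z}_2=\{0,1\}$ put $A_i=\{a\in\mathcal{O}(\mathbb{T}^2_\theta) : \sigma(a)=(-1)^i a\}$. Then $\mathcal{O}(\mathbb{T}^2_\theta)=A_0\oplus A_1$ is a strongly $\mathbb{Z}_2$-graded algebra, i.e. it is a $\mathbb{Z}_2$-graded algebra and $A_iA_j=A_{i+j}$ for all $i,j\in\mathbb{Z}_2$, where $A_iA_j$ denotes the linear span of all products $ab$ with $a\in A_i$, $b\in A_j$. Moreover, the noncommutative pillow algebra $\mathcal{O}(P_\theta)=A_0$, the fixed-point subalgebra of $\sigma$, is homologically smooth: as a bimodule over itself, that is, as a left module over $\mathcal{O}(P_\theta)\otimes_{\mathbb{C}}\mathcal{O}(P_\theta)^{\mathrm{op}}$,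 it has a projective resolution of finite length by finitely generated modules. -/

import Mathlib

open scoped TensorProduct

/-! ## Strongly graded algebras and homologically smooth algebras -/

/-- The family of subspaces `𝒜 g` (`g` in an additively written monoid `G`) makes `A` into a
strongly `G`-graded algebra: `A` is a `G`-graded `K`-algebra, i.e. `1 ∈ 𝒜 0`,
`𝒜 g * 𝒜 h ⊆ 𝒜 (g + h)` and `A` is the internal direct sum of the `𝒜 g`, and moreover
`𝒜 g * 𝒜 h = 𝒜 (g + h)`, where the left hand side is the span of all products. -/
structure IsStronglyGraded {K A G : Type*} [CommRing K] [Ring A] [Algebra K A]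
    [AddMonoid G] [DecidableEq G] (𝒜 : G → Submodule K A) : Prop where
  gradedMonoid : SetLike.GradedMonoid 𝒜
  isInternal : DirectSum.IsInternal 𝒜
  mul_eq : ∀ g h : G, 𝒜 g * 𝒜 h = 𝒜 (g + h)

/-- A `K`-algebra `B` regarded as a `B`-bimodule, that is, as a left module over the enveloping
algebra `B ⊗ Bᵒᵖ`, with the action `(a ⊗ b) • x = a x b`. -/
noncomputable def bimoduleSelf (K B : Type*) [CommRing K] [Ring B] [Algebra K B] :
    ModuleCat (B ⊗[K] Bᵐᵒᵖ) :=
  letI : Module (B ⊗[K] Bᵐᵒᵖ) B := instModuleTensorProductMop K B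
  ModuleCat.of (B ⊗[K] Bᵐᵒᵖ) B

/-- A `K`-algebra `B` is homologically smooth if, as a `B`-bimodule, it has a projective
resolution of finite length by finitely generated bimodules. -/
def IsHomologicallySmooth (K B : Type*) [CommRing K] [Ring B] [Algebra K B] : Prop :=
  ∃ P : CategoryTheory.ProjectiveResolution (bimoduleSelf K B),
    (∀ i : ℕ, Module.Finite (B ⊗[K] Bᵐᵒᵖ) (P.complex.X i)) ∧
    ∃ n : ℕ, ∀ i : ℕ, n < i → CategoryTheory.Limits.IsZero (P.complex.X i)

/-! ## The noncommutative torus -/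

/-- The deformation parameter `λ = e^{2πiθ}`. -/
noncomputable def torusParam (θ : ℝ) : ℂ := Complex.exp (2 * Real.pi * Complex.I * θ)

theorem torusParam_mul_star (θ : ℝ) : torusParam θ * star (torusParam θ) = 1 := by
  have h : star (torusParam θ) = Complex.exp (-(2 * Real.pi * Complex.I * θ)) := by
    simp [torusParam, ← Complex.exp_conj, Complex.conj_ofNat]
  rw [h, torusParam, ← Complex.exp_add, add_neg_cancel, Complex.exp_zero]

/-- The letters `U, U*, V, V*`. The free `*`-algebra on `U, V` is the free algebra on these. -/
inductive TorusGen : Type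
  | U | Us | V | Vs

/-- The involution `U ↔ U*`, `V ↔ V*` on letters. -/
def TorusGen.swap : TorusGen → TorusGen
  | U => Us
  | Us => U
  | V => Vs
  | Vs => V

/-- The defining relations: `U` and `V` are unitary and `U V = λ V U`, together with the
adjoint `V* U* = λ̄ U* V*` of the last relation. -/
inductive TorusRel (θ : ℝ) : FreeAlgebra ℂ TorusGen → FreeAlgebra ℂ TorusGen → Prop
  | U_mul_Us : TorusRel θ (FreeAlgebra.ι ℂ .U * FreeAlgebra.ι ℂ .Us) 1
  | Us_mul_U : TorusRel θ (FreeAlgebra.ι ℂ .Us * FreeAlgebra.ι ℂ .U) 1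
  | V_mul_Vs : TorusRel θ (FreeAlgebra.ι ℂ .V * FreeAlgebra.ι ℂ .Vs) 1
  | Vs_mul_V : TorusRel θ (FreeAlgebra.ι ℂ .Vs * FreeAlgebra.ι ℂ .V) 1
  | comm : TorusRel θ (FreeAlgebra.ι ℂ .U * FreeAlgebra.ι ℂ .V)
      (torusParam θ • (FreeAlgebra.ι ℂ .V * FreeAlgebra.ι ℂ .U))
  | comm_star : TorusRel θ (FreeAlgebra.ι ℂ .Vs * FreeAlgebra.ι ℂ .Us)
      (star (torusParam θ) • (FreeAlgebra.ι ℂ .Us * FreeAlgebra.ι ℂ .Vs))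

/-- The coordinate algebra `𝒪(𝕋²_θ)` of the noncommutative torus. -/
def NCTorus (θ : ℝ) : Type := RingQuot (TorusRel θ)

namespace NCTorus

variable (θ : ℝ)

noncomputable instance : Ring (NCTorus θ) := inferInstanceAs (Ring (RingQuot (TorusRel θ)))

noncomputable instance : Algebra ℂ (NCTorus θ) :=
  inferInstanceAs (Algebra ℂ (RingQuot (TorusRel θ)))

/-- The quotient map from the free algebra. -/
noncomputable def mk : FreeAlgebra ℂ TorusGen →ₐ[ℂ] NCTorus θ :=
  RingQuot.mkAlgHom ℂ (TorusRel θ)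

/-- The class of a letter. -/
noncomputable def gen (x : TorusGen) : NCTorus θ := mk θ (FreeAlgebra.ι ℂ x)

/-- The unitary generator `U`. -/
noncomputable def U : NCTorus θ := gen θ .U

/-- The unitary generator `V`. -/
noncomputable def V : NCTorus θ := gen θ .V

theorem rel {a b : FreeAlgebra ℂ TorusGen} (h : TorusRel θ a b) : mk θ a = mk θ b :=
  RingQuot.mkAlgHom_rel ℂ h

theorem U_mul_Us : gen θ .U * gen θ .Us = 1 := by
  simpa [gen] using rel θ .U_mul_Us

theorem Us_mul_U : gen θ .Us * gen θ .U = 1 := by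
  simpa [gen] using rel θ .Us_mul_U

theorem V_mul_Vs : gen θ .V * gen θ .Vs = 1 := by
  simpa [gen] using rel θ .V_mul_Vs

theorem Vs_mul_V : gen θ .Vs * gen θ .V = 1 := by
  simpa [gen] using rel θ .Vs_mul_V

theorem comm : gen θ .U * gen θ .V = torusParam θ • (gen θ .V * gen θ .U) := by
  simpa only [gen, map_mul, map_smul] using rel θ .comm

theorem comm_star :
    gen θ .Vs * gen θ .Us = star (torusParam θ) • (gen θ .Us * gen θ .Vs) := by
  simpa only [gen, map_mul, map_smul] using rel θ .comm_star

theorem comm_swap : gen θ .Us * gen θ .Vs = torusParam θ • (gen θ .Vs * gen θ .Us) := by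
  rw [comm_star, smul_smul, torusParam_mul_star, one_smul]

theorem comm_star_swap :
    gen θ .V * gen θ .U = star (torusParam θ) • (gen θ .U * gen θ .V) := by
  rw [comm, smul_smul, mul_comm, torusParam_mul_star, one_smul]

theorem algHom_ext {A : Type*} [Semiring A] [Algebra ℂ A] {f g : NCTorus θ →ₐ[ℂ] A}
    (h : ∀ x, f (gen θ x) = g (gen θ x)) : f = g :=
  RingQuot.ringQuot_ext' ℂ f g (FreeAlgebra.hom_ext (funext h))

@[elab_as_elim]
theorem induction_on {p : NCTorus θ → Prop} (a : NCTorus θ)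
    (algebraMap : ∀ c : ℂ, p (algebraMap ℂ _ c)) (gen : ∀ x, p (gen θ x))
    (add : ∀ a b, p a → p b → p (a + b)) (mul : ∀ a b, p a → p b → p (a * b)) : p a := by
  obtain ⟨b, rfl⟩ : ∃ b, mk θ b = a := RingQuot.mkAlgHom_surjective ℂ _ a
  induction b using FreeAlgebra.induction with
  | grade0 r => simpa using algebraMap r
  | grade1 x => exact gen x
  | mul a b ha hb => simpa using mul _ _ ha hb
  | add a b ha hb => simpa using add _ _ ha hb

/-! ### The `*`-structure -/

/-- The opposite algebra of `𝒪(𝕋²_θ)` with the complex conjugate scalar multiplication. -/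
noncomputable abbrev conjOpAlgebra : Algebra ℂ (NCTorus θ)ᵐᵒᵖ :=
  ((algebraMap ℂ (NCTorus θ)ᵐᵒᵖ).comp (starRingEnd ℂ)).toAlgebra'
    (fun c x => Algebra.commutes (starRingEnd ℂ c) x)

/-- The conjugate-linear anti-multiplicative map on the free algebra determined by
`U ↔ U*`, `V ↔ V*`, with values in the quotient. -/
noncomputable def preStar : FreeAlgebra ℂ TorusGen →+* (NCTorus θ)ᵐᵒᵖ :=
  letI := conjOpAlgebra θ
  (FreeAlgebra.lift ℂ (fun x : TorusGen => MulOpposite.op (gen θ x.swap))).toRingHom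

theorem preStar_ι (x : TorusGen) :
    preStar θ (FreeAlgebra.ι ℂ x) = MulOpposite.op (gen θ x.swap) := by
  let _ := conjOpAlgebra θ
  exact FreeAlgebra.lift_ι_apply _ _

theorem preStar_algebraMap (c : ℂ) :
    preStar θ (algebraMap ℂ _ c) = MulOpposite.op (algebraMap ℂ _ (star c)) := by
  let _ := conjOpAlgebra θ
  exact (FreeAlgebra.lift ℂ (fun x : TorusGen => MulOpposite.op (gen θ x.swap))).commutes c

theorem preStar_smul (c : ℂ) (a : FreeAlgebra ℂ TorusGen) :
    preStar θ (c • a) = MulOpposite.op (star c • (preStar θ a).unop) := by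
  rw [Algebra.smul_def, map_mul, preStar_algebraMap, Algebra.smul_def, Algebra.commutes]
  rfl

theorem preStar_rel {a b : FreeAlgebra ℂ TorusGen} (h : TorusRel θ a b) :
    preStar θ a = preStar θ b := by
  apply MulOpposite.unop_injective
  cases h <;>
    simp only [preStar_smul, map_mul, map_one, preStar_ι, MulOpposite.unop_mul,
      MulOpposite.unop_op, MulOpposite.unop_one, TorusGen.swap, U_mul_Us, Us_mul_U, V_mul_Vs,
      Vs_mul_V, star_star]
  · exact comm_star θ
  · exact comm θ

/-- The `*`-operation as a ring homomorphism to the opposite ring. -/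
noncomputable def starHom : NCTorus θ →+* (NCTorus θ)ᵐᵒᵖ :=
  RingQuot.lift ⟨preStar θ, fun _ _ h => preStar_rel θ h⟩

theorem starHom_mk (a : FreeAlgebra ℂ TorusGen) : starHom θ (mk θ a) = preStar θ a := by
  have : mk θ a = RingQuot.mkRingHom (TorusRel θ) a :=
    congrArg (fun f : FreeAlgebra ℂ TorusGen →+* RingQuot (TorusRel θ) => f a)
      (RingQuot.mkAlgHom_coe ℂ (TorusRel θ))
  rw [this]
  exact RingQuot.lift_mkRingHom_apply _ _ _

theorem starHom_gen (x : TorusGen) : starHom θ (gen θ x) = MulOpposite.op (gen θ x.swap) := by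
  rw [gen, starHom_mk, preStar_ι]

theorem starHom_algebraMap (c : ℂ) :
    starHom θ (algebraMap ℂ _ c) = MulOpposite.op (algebraMap ℂ _ (star c)) := by
  rw [← (mk θ).commutes, starHom_mk, preStar_algebraMap]

/-- The conjugate-linear involution with `U ↔ U*`, `V ↔ V*`. -/
noncomputable instance : StarRing (NCTorus θ) where
  star a := (starHom θ a).unop
  star_involutive a := by
    induction a using induction_on with
    | algebraMap c => simp [starHom_algebraMap]
    | gen x => cases x <;> simp [starHom_gen, TorusGen.swap]
    | add a b ha hb => simp [ha, hb]
    | mul a b ha hb => simp [ha, hb]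
  star_mul a b := by simp
  star_add a b := by simp

theorem star_def (a : NCTorus θ) : star a = (starHom θ a).unop := rfl

instance : StarModule ℂ (NCTorus θ) where
  star_smul c a := by
    rw [Algebra.smul_def, star_mul, star_def θ (algebraMap ℂ _ c), starHom_algebraMap,
      Algebra.smul_def, Algebra.commutes]
    rfl

theorem star_gen (x : TorusGen) : star (gen θ x) = gen θ x.swap := by
  rw [star_def, starHom_gen, MulOpposite.unop_op]

theorem U_mem_unitary : U θ ∈ unitary (NCTorus θ) := by
  rw [Unitary.mem_iff, U, star_gen]
  exact ⟨Us_mul_U θ, U_mul_Us θ⟩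

theorem V_mem_unitary : V θ ∈ unitary (NCTorus θ) := by
  rw [Unitary.mem_iff, V, star_gen]
  exact ⟨Vs_mul_V θ, V_mul_Vs θ⟩

theorem U_mul_V : U θ * V θ = torusParam θ • (V θ * U θ) := comm θ

/-! ### The flip, the induced grading and the pillow algebra -/

/-- The flip as an algebra endomorphism: `U ↔ U*`, `V ↔ V*`. -/
noncomputable def flipHom : NCTorus θ →ₐ[ℂ] NCTorus θ :=
  RingQuot.liftAlgHom ℂ ⟨FreeAlgebra.lift ℂ (fun x : TorusGen => gen θ x.swap), by
    intro a b h
    cases h <;>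
      simp only [map_smul, map_mul, map_one, FreeAlgebra.lift_ι_apply, TorusGen.swap,
        U_mul_Us, Us_mul_U, V_mul_Vs, Vs_mul_V]
    · exact comm_swap θ
    · exact comm_star_swap θ⟩

theorem flipHom_gen (x : TorusGen) : flipHom θ (gen θ x) = gen θ x.swap := by
  refine (RingQuot.liftAlgHom_mkAlgHom_apply ℂ _ _ _).trans ?_
  exact FreeAlgebra.lift_ι_apply _ _

theorem flipHom_comp_self : (flipHom θ).comp (flipHom θ) = AlgHom.id ℂ (NCTorus θ) := by
  apply algHom_ext
  intro x
  cases x <;> simp [flipHom_gen, TorusGen.swap]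

/-- The flip `σ`, the involutive algebra automorphism with `σ(U) = U*` and `σ(V) = V*`. -/
noncomputable def flip : NCTorus θ ≃ₐ[ℂ] NCTorus θ :=
  AlgEquiv.ofAlgHom (flipHom θ) (flipHom θ) (flipHom_comp_self θ) (flipHom_comp_self θ)

theorem flip_U : flip θ (U θ) = star (U θ) := by
  rw [U, star_gen]
  exact flipHom_gen θ _

theorem flip_V : flip θ (V θ) = star (V θ) := by
  rw [V, star_gen]
  exact flipHom_gen θ _

/-- The `ℤ/2`-grading defined by the flip: the component of degree `i` is the eigenspace
`{a | σ(a) = (-1)^i a}`. -/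
noncomputable def flipGrading (i : ZMod 2) : Submodule ℂ (NCTorus θ) :=
  Module.End.eigenspace (flip θ).toLinearMap ((-1 : ℂ) ^ i.val)

/-- The noncommutative pillow algebra `𝒪(P_θ)`, the fixed-point subalgebra of the flip. -/
noncomputable def pillow : Subalgebra ℂ (NCTorus θ) :=
  AlgHom.equalizer (flip θ : NCTorus θ →ₐ[ℂ] NCTorus θ) (AlgHom.id ℂ (NCTorus θ))

/-- The pillow algebra is the degree-zero part of the grading. -/
theorem toSubmodule_pillow : Subalgebra.toSubmodule (pillow θ) = flipGrading θ 0 := by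
  ext a
  simp [pillow, flipGrading]

end NCTorus

/-! Write `A` for the torus algebra, `B` for the pillow algebra `A₀`, and `Aᵉ`, `Bᵉ` for their
enveloping algebras.

Strong grading comes down to `1 ∈ A₁A₁`, which is an explicit identity between odd elements such as
`U - U*`, `UV - U*V*` and `UV* - U*V`. It needs only `λ⁴ ≠ 1` (`one_mem_flipGrading_one_mul_self`).

For smoothness, `A` has a Koszul resolution of length two over `Aᵉ`. The elements `U ⊗ U⁻¹` and `V ⊗
V⁻¹` commute, because the two powers of `λ` cancel. Subtracting `1` from each gives a regular
sequence that generates the kernel of multiplication. Regularity follows from the gradings of `Aᵉ`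
by degree in `V` and in `U` (`mem_of_mul_sub_mem`, `HasFiniteResolution.koszul`).

Writing `1` as a sum of products of odd elements also gives dual bases of `A` over `B` on both
sides. Hence `Aᵉ` is finitely generated projective over `Bᵉ` (`env_finite_and_projective`), and the
Koszul resolution remains a finite projective one after restriction to `Bᵉ`. Averaging over the flip
makes `B` a direct summand of `A` as a `B`-bimodule, and finite resolutions pass to direct summands
without growing in length, by Schanuel's lemma (`of_retract`). -/

/-! ### Finite resolutions by finitely generated projectives -/

/-- `M` has a resolution `0 → Pₙ → ⋯ → P₀ → M → 0` by finitely generated projective modules. -/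
def HasFiniteResolution (R : Type u) [Ring R] : ℕ → ModuleCat.{u} R → Prop
  | 0, M => Module.Finite R M ∧ Module.Projective R M
  | n + 1, M => ∃ (F : ModuleCat.{u} R) (f : F →ₗ[R] M), Module.Finite R F ∧
      Module.Projective R F ∧ Function.Surjective f ∧
      HasFiniteResolution R n (ModuleCat.of R (LinearMap.ker f))

namespace HasFiniteResolution

variable {R : Type u} [Ring R]

theorem of_equiv {n : ℕ} {M N : Type u} [AddCommGroup M] [Module R M] [AddCommGroup N]
    [Module R N] (e : M ≃ₗ[R] N) (h : HasFiniteResolution R n (ModuleCat.of R M)) :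
    HasFiniteResolution R n (ModuleCat.of R N) := by
  cases n with
  | zero =>
    obtain ⟨h₁, h₂⟩ := h
    have h₁ : Module.Finite R M := h₁
    have h₂ : Module.Projective R M := h₂
    exact ⟨Module.Finite.equiv e, Module.Projective.of_equiv e⟩
  | succ n =>
    obtain ⟨F, f, h₁, h₂, h₃, h₄⟩ := h
    let f : F →ₗ[R] M := f
    refine ⟨F, e.toLinearMap ∘ₗ f, h₁, h₂, e.surjective.comp h₃, ?_⟩
    rw [LinearEquiv.ker_comp]
    exact h₄

theorem of_exact {n : ℕ} {K F M : Type u} [AddCommGroup K] [Module R K] [AddCommGroup F]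
    [Module R F] [AddCommGroup M] [Module R M] [Module.Finite R F] [Module.Projective R F]
    (i : K →ₗ[R] F) (g : F →ₗ[R] M) (hi : Function.Injective i)
    (hig : LinearMap.range i = LinearMap.ker g) (hg : Function.Surjective g)
    (h : HasFiniteResolution R n (ModuleCat.of R K)) :
    HasFiniteResolution R (n + 1) (ModuleCat.of R M) :=
  ⟨ModuleCat.of R F, g, ‹_›, ‹_›, hg,
    h.of_equiv ((LinearEquiv.ofInjective i hi).trans (LinearEquiv.ofEq _ _ hig))⟩

theorem finite {n : ℕ} {M : Type u} [AddCommGroup M] [Module R M]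
    (h : HasFiniteResolution R n (ModuleCat.of R M)) : Module.Finite R M := by
  cases n with
  | zero => exact h.1
  | succ n =>
    obtain ⟨F, f, h₁, -, h₃, -⟩ := h
    exact Module.Finite.of_surjective (M := F) (P := M) f h₃

theorem prod_projective {n : ℕ} {M G : Type u} [AddCommGroup M] [Module R M] [AddCommGroup G]
    [Module R G] [Module.Finite R G] [Module.Projective R G]
    (h : HasFiniteResolution R n (ModuleCat.of R M)) :
    HasFiniteResolution R n (ModuleCat.of R (M × G)) := by
  cases n with
  | zero =>
    obtain ⟨h₁, h₂⟩ := h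
    have h₁ : Module.Finite R M := h₁
    have h₂ : Module.Projective R M := h₂
    exact ⟨inferInstanceAs (Module.Finite R (M × G)), inferInstanceAs (Module.Projective R (M × G))⟩
  | succ n =>
    obtain ⟨F, f, h₁, h₂, h₃, h₄⟩ := h
    let f : F →ₗ[R] M := f
    refine of_exact (F := F × G) (LinearMap.inl R F G ∘ₗ (LinearMap.ker f).subtype)
      (f.prodMap LinearMap.id) ?_ ?_ ?_ h₄
    · exact LinearMap.inl_injective.comp Subtype.val_injective
    · ext ⟨a, b⟩
      simp only [LinearMap.mem_range, LinearMap.mem_ker, LinearMap.prodMap_apply, Prod.mk_eq_zero,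
        LinearMap.comp_apply, LinearMap.inl_apply, Prod.mk.injEq, LinearMap.id_apply]
      constructor
      · rintro ⟨⟨y, hy⟩, rfl, rfl⟩
        exact ⟨hy, rfl⟩
      · rintro ⟨ha, rfl⟩
        exact ⟨⟨a, ha⟩, rfl, rfl⟩
    · exact h₃.prodMap Function.surjective_id

/-- Lifting the inclusion of the projective module `G` through the cover `f : F → K × G` gives `s`.
The composite `F → K` is then a cover of `K` with kernel `ker f ⊕ s(G)`, so `G` moves into the next
syzygy. -/
theorem of_prod_projective {n : ℕ} {K G : Type u} [AddCommGroup K] [Module R K] [AddCommGroup G]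
    [Module R G] [Module.Finite R G] [Module.Projective R G]
    (h : HasFiniteResolution R n (ModuleCat.of R (K × G))) :
    HasFiniteResolution R n (ModuleCat.of R K) := by
  cases n with
  | zero =>
    obtain ⟨h₁, h₂⟩ := h
    have h₁ : Module.Finite R (K × G) := h₁
    have h₂ : Module.Projective R (K × G) := h₂
    exact ⟨Module.Finite.of_surjective (LinearMap.fst R K G) LinearMap.fst_surjective,
      Module.Projective.of_split (LinearMap.inl R K G) (LinearMap.fst R K G) (by ext; rfl)⟩
  | succ n =>
    obtain ⟨F, f, h₁, h₂, h₃, h₄⟩ := h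
    let f : F →ₗ[R] K × G := f
    obtain ⟨s, hs⟩ := Module.projective_lifting_property f (LinearMap.inr R K G) h₃
    have hs (g : G) : f (s g) = (0, g) := LinearMap.congr_fun hs g
    let i : LinearMap.ker f × G →ₗ[R] F := (LinearMap.ker f).subtype.coprod s
    refine of_exact i (LinearMap.fst R K G ∘ₗ f) ?_ ?_
      (fun k => (h₃ (k, 0)).imp fun _ hx => congrArg Prod.fst hx)
      (prod_projective h₄)
    · refine (injective_iff_map_eq_zero i).2 ?_
      rintro ⟨⟨x, hx⟩, g⟩ h
      have h : x + s g = 0 := h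
      have hx : f x = 0 := hx
      have h' := congrArg f h
      rw [map_add, hx, hs, zero_add, map_zero, Prod.mk_eq_zero] at h'
      obtain rfl := h'.2
      simp_all
    · ext x
      constructor
      · rintro ⟨⟨⟨x, hx⟩, g⟩, rfl⟩
        have hx : f x = 0 := hx
        change (f (x + s g)).1 = 0
        rw [map_add, hx, hs, zero_add]
      · intro hx
        have hx : (f x).1 = 0 := hx
        refine ⟨⟨⟨x - s (f x).2, ?_⟩, (f x).2⟩, ?_⟩
        · rw [LinearMap.mem_ker, map_sub, hs]
          ext <;> simp [hx]
        · exact sub_add_cancel x _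

/-- The fibre product of `f` and `g` splits as `ker f × G` when `g` lifts through `f`. -/
def kerProdEquivEqLocus {F G X : Type u} [AddCommGroup F] [Module R F] [AddCommGroup G]
    [Module R G] [AddCommGroup X] [Module R X] (f : F →ₗ[R] X) (g : G →ₗ[R] X) (s : G →ₗ[R] F)
    (hs : f ∘ₗ s = g) :
    (LinearMap.ker f × G) ≃ₗ[R]
      LinearMap.eqLocus (f ∘ₗ LinearMap.fst R F G) (g ∘ₗ LinearMap.snd R F G) where
  toFun p := ⟨(p.1 + s p.2, p.2), by
    have h : f p.1 = 0 := p.1.2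
    simp [← hs, h]⟩
  map_add' p q := by
    ext <;> simp
    abel
  map_smul' c p := by ext <;> simp
  invFun p := (⟨p.1.1 - s p.1.2, by
    have h : f p.1.1 = g p.1.2 := p.2
    simp [← hs, h]⟩, p.1.2)
  left_inv p := by ext <;> simp
  right_inv p := by ext <;> simp

/-- The fibre products of `f, g` and of `g, f` agree. -/
def eqLocusSwap {F G X : Type u} [AddCommGroup F] [Module R F] [AddCommGroup G]
    [Module R G] [AddCommGroup X] [Module R X] (f : F →ₗ[R] X) (g : G →ₗ[R] X) :
    LinearMap.eqLocus (f ∘ₗ LinearMap.fst R F G) (g ∘ₗ LinearMap.snd R F G) ≃ₗ[R]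
      LinearMap.eqLocus (g ∘ₗ LinearMap.fst R G F) (f ∘ₗ LinearMap.snd R G F) where
  toFun p := ⟨p.1.swap, p.2.symm⟩
  map_add' _ _ := rfl
  map_smul' _ _ := rfl
  invFun p := ⟨p.1.swap, p.2.symm⟩
  left_inv _ := rfl
  right_inv _ := rfl

/-- Schanuel's lemma: the fibre product of two projective covers `f` and `g` of `X` splits both as
`ker f × G` and as `ker g × F`. So any cover of `X` by a finitely generated projective can start a
resolution of the same length. -/
theorem ker {n : ℕ} {G X : Type u} [AddCommGroup G] [Module R G] [AddCommGroup X] [Module R X]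
    [Module.Finite R G] [Module.Projective R G] (g : G →ₗ[R] X) (hg : Function.Surjective g)
    (h : HasFiniteResolution R (n + 1) (ModuleCat.of R X)) :
    HasFiniteResolution R n (ModuleCat.of R (LinearMap.ker g)) := by
  obtain ⟨F, f, h₁, h₂, h₃, h₄⟩ := h
  let f : F →ₗ[R] X := f
  obtain ⟨s, hs⟩ := Module.projective_lifting_property f g h₃
  obtain ⟨t, ht⟩ := Module.projective_lifting_property g f hg
  exact of_prod_projective (G := F) ((prod_projective (G := G) h₄).of_equiv
    ((kerProdEquivEqLocus f g s hs).trans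
      ((eqLocusSwap f g).trans (kerProdEquivEqLocus g f t ht).symm)))

/-- If the two factors are covered separately by free modules, the kernel of the product cover is
the product of the kernels. By `ker` it has a resolution one step shorter, so induction applies to
it. -/
theorem of_prod {n : ℕ} {M N : Type u} [AddCommGroup M] [Module R M] [AddCommGroup N]
    [Module R N] (h : HasFiniteResolution R n (ModuleCat.of R (M × N))) :
    HasFiniteResolution R n (ModuleCat.of R M) := by
  induction n generalizing M N with
  | zero =>
    obtain ⟨h₁, h₂⟩ := h
    have h₁ : Module.Finite R (M × N) := h₁
    have h₂ : Module.Projective R (M × N) := h₂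
    exact ⟨Module.Finite.of_surjective (LinearMap.fst R M N) LinearMap.fst_surjective,
      Module.Projective.of_split (LinearMap.inl R M N) (LinearMap.fst R M N) (by ext; rfl)⟩
  | succ n ih =>
    have := h.finite
    have : Module.Finite R M :=
      Module.Finite.of_surjective (LinearMap.fst R M N) LinearMap.fst_surjective
    have : Module.Finite R N :=
      Module.Finite.of_surjective (LinearMap.snd R M N) LinearMap.snd_surjective
    obtain ⟨a, f, hf⟩ := Module.Finite.exists_fin' R M
    obtain ⟨b, g, hg⟩ := Module.Finite.exists_fin' R N
    have hk := ker (f.prodMap g) (hf.prodMap hg) h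
    let e : LinearMap.ker (f.prodMap g) ≃ₗ[R] LinearMap.ker f × LinearMap.ker g :=
      { toFun := fun p => (⟨p.1.1, congrArg Prod.fst p.2⟩, ⟨p.1.2, congrArg Prod.snd p.2⟩)
        map_add' := fun _ _ => rfl
        map_smul' := fun _ _ => rfl
        invFun := fun p => ⟨(p.1, p.2), Prod.ext p.1.2 p.2.2⟩
        left_inv := fun _ => rfl
        right_inv := fun _ => rfl }
    exact ⟨ModuleCat.of R (Fin a → R), f, inferInstanceAs (Module.Finite R (Fin a → R)),
      inferInstanceAs (Module.Projective R (Fin a → R)), hf,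
      ih (hk.of_equiv e)⟩

theorem of_retract {n : ℕ} {M N : Type u} [AddCommGroup M] [Module R M] [AddCommGroup N]
    [Module R N] (i : N →ₗ[R] M) (r : M →ₗ[R] N) (hri : ∀ x, r (i x) = x)
    (h : HasFiniteResolution R n (ModuleCat.of R M)) :
    HasFiniteResolution R n (ModuleCat.of R N) := by
  let e : M ≃ₗ[R] N × LinearMap.ker r :=
    { toFun := fun m => (r m, ⟨m - i (r m), by simp [hri]⟩)
      map_add' := fun a b => by ext <;> simp; abel
      map_smul' := fun c a => by ext <;> simp [smul_sub]
      invFun := fun p => i p.1 + p.2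
      left_inv := fun m => by simp
      right_inv := fun p => by
        have h : r p.2 = 0 := p.2.2
        ext <;> simp [hri, h] }
  exact of_prod (h.of_equiv e)

open CategoryTheory

/-- Splice a projective resolution of the kernel of `P → M` with `P → M`. -/
theorem exists_projectiveResolution_of_shortExact {S : ShortComplex (ModuleCat.{u} R)}
    (hS : S.ShortExact) [Projective S.X₂] (Q : ProjectiveResolution S.X₁) :
    ∃ P : ProjectiveResolution S.X₃, P.complex.X 0 = S.X₂ ∧
      ∀ i, P.complex.X (i + 1) = Q.complex.X i := by
  have := hS.mono_f
  have := hS.epi_g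
  let ε : Q.complex.X 0 ⟶ S.X₁ := Q.π.f 0
  have hε : Q.complex.d 1 0 ≫ ε = 0 := Q.complex_d_comp_π_f_zero
  have hexε : (ShortComplex.mk _ _ hε).Exact := Q.exact₀
  have : Epi ε := inferInstanceAs (Epi (Q.π.f 0))
  -- The resolution of the kernel moves up by one degree, and `S.X₂` becomes the term in degree
  -- zero.
  let K := Q.complex.augment (ε ≫ S.f) (by rw [reassoc_of% hε, Limits.zero_comp])
  let g : K.X 0 ⟶ S.X₃ := S.g
  have hw : K.d 1 0 ≫ g = 0 := by
    change (ε ≫ S.f) ≫ S.g = 0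
    rw [Category.assoc, S.zero, Limits.comp_zero]
  have hex (n : ℕ) : K.ExactAt (n + 1) := by
    rw [HomologicalComplex.exactAt_iff' _ (n + 1 + 1) (n + 1) n (by simp) (by simp)]
    cases n with
    | zero =>
      -- At the splice, `S.f` is injective, so composing `ε` with it does not change the kernel.
      refine (ShortComplex.moduleCat_exact_iff _).2 fun (x : Q.complex.X 0) hx => ?_
      refine (ShortComplex.moduleCat_exact_iff _).1 hexε x ?_
      exact (ModuleCat.mono_iff_injective S.f).1 inferInstance (hx.trans (map_zero S.f.hom).symm)
    | succ n =>
      have := Q.complex_exactAt_succ n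
      rw [HomologicalComplex.exactAt_iff' _ (n + 1 + 1) (n + 1) n (by simp) (by simp)] at this
      exact this
  refine ⟨⟨K, ?_, (ChainComplex.toSingle₀Equiv K S.X₃).symm ⟨g, hw⟩, ⟨fun n => ?_⟩⟩, rfl, fun _ => rfl⟩
  · rintro (_ | n)
    · assumption
    · exact Q.projective n
  · cases n with
    | zero =>
      -- In degree zero, being a quasi-isomorphism means that `K.X 1 → K.X 0 → S.X₃` is exact with
      -- `S.g` epi.
      rw [ChainComplex.quasiIsoAt₀_iff, ShortComplex.quasiIso_iff_of_zeros']
      · refine (ShortComplex.exact_and_epi_g_iff_of_iso (S₂ := ShortComplex.mk _ _ hw) ?_).2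
          ⟨?_, ‹Epi S.g›⟩
        · exact ShortComplex.isoMk (Iso.refl _) (Iso.refl _) (Iso.refl _)
            ((Category.id_comp _).trans (Category.comp_id _).symm)
            (by
              change 𝟙 (K.X 0) ≫ g = ((K.toSingle₀Equiv S.X₃).symm ⟨g, hw⟩).f 0 ≫ 𝟙 _
              rw [Category.id_comp, ChainComplex.toSingle₀Equiv_symm_apply_f_zero]
              exact (Category.comp_id g).symm)
        · refine (ShortComplex.moduleCat_exact_iff _).2 fun (x : S.X₂) hx => ?_
          obtain ⟨y, rfl⟩ := (ShortComplex.moduleCat_exact_iff _).1 hS.exact x hx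
          obtain ⟨z, rfl⟩ := (ModuleCat.epi_iff_surjective ε).1 inferInstance y
          exact ⟨z, rfl⟩
      all_goals rfl
    | succ n =>
      rw [quasiIsoAt_iff_exactAt']
      · exact hex n
      · apply ChainComplex.exactAt_succ_single_obj

theorem exists_projectiveResolution {n : ℕ} {M : ModuleCat.{u} R}
    (h : HasFiniteResolution R n M) :
    ∃ P : ProjectiveResolution M, (∀ i, Module.Finite R (P.complex.X i)) ∧
      ∀ i, n < i → Limits.IsZero (P.complex.X i) := by
  induction n generalizing M with
  | zero =>
    have h₁ : Module.Finite R M := h.1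
    have h₂ : Module.Projective R M := h.2
    have : Projective M := inferInstance
    have hz (i : ℕ) (hi : 0 < i) : Limits.IsZero ((ProjectiveResolution.self M).complex.X i) :=
      HomologicalComplex.isZero_single_obj_X _ _ _ _ hi.ne'
    refine ⟨ProjectiveResolution.self M, fun i => ?_, hz⟩
    rcases i.eq_zero_or_pos with rfl | hi
    · exact h₁
    · have := ModuleCat.subsingleton_of_isZero (hz i hi)
      infer_instance
  | succ n ih =>
    obtain ⟨F, f, h₁, h₂, h₃, h₄⟩ := h
    obtain ⟨Q, hQ₁, hQ₂⟩ := ih h₄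
    have : Projective F := ModuleCat.projective_of_categoryTheory_projective F
    let S : ShortComplex (ModuleCat.{u} R) :=
      ShortComplex.mk (ModuleCat.ofHom (LinearMap.ker f).subtype) (ModuleCat.ofHom f)
        (by ext x; exact x.2)
    have hS : S.ShortExact :=
      { exact := (ShortComplex.moduleCat_exact_iff _).2 fun x hx => ⟨⟨x, hx⟩, rfl⟩
        mono_f := (ModuleCat.mono_iff_injective _).2 Subtype.val_injective
        epi_g := (ModuleCat.epi_iff_surjective _).2 h₃ }
    obtain ⟨P, hP₀, hP⟩ := exists_projectiveResolution_of_shortExact hS Q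
    refine ⟨P, ?_, ?_⟩
    · rintro (_ | i)
      · rw [hP₀]
        exact h₁
      · rw [hP]
        exact hQ₁ i
    · rintro (_ | i) hi
      · omega
      · rw [hP]
        exact hQ₂ i (by omega)

end HasFiniteResolution

/-! ### Regularity from a grading -/

/-- Modulo `N`, each coefficient is the previous one times `b`. The coefficients vanish far enough
to the left, so membership propagates upwards. -/
theorem LaurentPolynomial.coeff_mem_of_eq {T : Type*} [Ring T] (N : Submodule T T) (b : T)
    (hNb : ∀ t ∈ N, t * b ∈ N) (p : LaurentPolynomial T)
    (h : ∀ n : ℤ, p.coeff (n - 1) * b - p.coeff n ∈ N) (n : ℤ) : p.coeff n ∈ N := by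
  obtain ⟨m, hm⟩ : ∃ m : ℤ, ∀ k ≤ m, p.coeff k = 0 := by
    obtain ⟨m, hm⟩ := p.coeff.support.bddBelow
    refine ⟨m - 1, fun k hk => ?_⟩
    by_contra hp
    have := hm (Finsupp.mem_support_iff.2 hp)
    omega
  rcases le_total n m with hn | hn
  · rw [hm n hn]
    exact N.zero_mem
  · induction n, hn using Int.leInduction with
    | base => rw [hm m le_rfl]; exact N.zero_mem
    | succ k hk ih =>
      have := h (k + 1)
      rw [add_sub_cancel_right] at this
      simpa using N.sub_mem (hNb _ ih) this

/-- The evaluation of a Laurent polynomial at `1`. -/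
noncomputable def LaurentPolynomial.augmentation (k T : Type*) [CommRing k] [Ring T] [Algebra k T] :
    LaurentPolynomial T →ₐ[k] T :=
  AddMonoidAlgebra.liftNCAlgHom (AlgHom.id k T) 1 (fun _ _ => Commute.one_right _)

theorem LaurentPolynomial.augmentation_single {k T : Type*} [CommRing k] [Ring T] [Algebra k T]
    (n : ℤ) (t : T) : LaurentPolynomial.augmentation k T (.single n t) = t := by
  simp [augmentation, -single_eq_C_mul_T]

theorem LaurentPolynomial.augmentation_mem {k T : Type*} [CommRing k] [Ring T] [Algebra k T]
    (N : Submodule T T) (p : LaurentPolynomial T) (h : ∀ n, p.coeff n ∈ N) :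
    LaurentPolynomial.augmentation k T p ∈ N := by
  rw [← AddMonoidAlgebra.sum_coeff_single p, Finsupp.sum, map_sum]
  refine N.sum_mem fun n _ => ?_
  rw [augmentation_single]
  exact h n

/-- If `b` is homogeneous of degree one for a coaction `ρ` of the Laurent polynomial ring, then
right multiplication by `b - 1` is injective modulo every graded left ideal stable under `b`. -/
theorem mem_of_mul_sub_mem {k T : Type*} [CommRing k] [Ring T] [Algebra k T]
    (ρ : T →ₐ[k] LaurentPolynomial T)
    (hρ : (LaurentPolynomial.augmentation k T).comp ρ = AlgHom.id k T) (b : T)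
    (hb : ρ b = .single 1 b) (N : Submodule T T)
    (hNb : ∀ t ∈ N, t * b ∈ N) (hN : ∀ t ∈ N, ∀ n, (ρ t).coeff n ∈ N) (t : T)
    (ht : t * (b - 1) ∈ N) : t ∈ N := by
  rw [← AlgHom.id_apply (R := k) t, ← hρ]
  refine LaurentPolynomial.augmentation_mem N _
    (LaurentPolynomial.coeff_mem_of_eq N b hNb (ρ t) fun n => ?_)
  -- Since `b` has degree one, the coefficient of `ρ (t * (b - 1))` at `n` is that of `ρ t` at `n -
  -- 1` times `b`, minus that of `ρ t` at `n`.
  have := hN _ ht n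
  rw [mul_sub, mul_one, map_sub, map_mul, hb] at this
  simpa [AddMonoidAlgebra.coeff_mul_single_apply, -LaurentPolynomial.single_eq_C_mul_T,
    sub_eq_add_neg] using this

/-! ### The Koszul resolution of length two -/

section Koszul

variable {S T M : Type u} [Ring S] [Ring T] [Module S T] [IsScalarTower S T T]
  [AddCommGroup M] [Module S M]

/-- Right multiplication as a linear map over a base ring acting from the left. -/
def rightMul (S : Type u) {T : Type u} [Ring S] [Ring T] [Module S T] [IsScalarTower S T T]
    (x : T) : T →ₗ[S] T where
  toFun t := t * x
  map_add' a b := add_mul a b x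
  map_smul' c a := smul_mul_assoc c a x

/-- This is the complex `0 → T → T² → T → M → 0` of a regular sequence `x, y` acting by right
multiplication. Exactness is a matter of `T` alone; `S` enters only through linearity of the maps
and projectivity of the terms. -/
theorem HasFiniteResolution.koszul [Module.Finite S T] [Module.Projective S T] {x y : T}
    (hxy : Commute x y) (hx : ∀ t, t * x = 0 → t = 0)
    (hy : ∀ t, t * y ∈ Submodule.span T {x} → t ∈ Submodule.span T {x})
    (ε : T →ₗ[S] M) (hε : Function.Surjective ε)
    (hker : ∀ t, ε t = 0 ↔ ∃ a b, a * x + b * y = t) :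
    HasFiniteResolution S 2 (ModuleCat.of S M) := by
  have h₀ : HasFiniteResolution S 0 (ModuleCat.of S T) := ⟨‹_›, ‹_›⟩
  let d₁ : T × T →ₗ[S] LinearMap.ker ε :=
    ((rightMul S x).coprod (rightMul S y)).codRestrict _ fun p => (hker _).2 ⟨p.1, p.2, rfl⟩
  let d₂ : T →ₗ[S] T × T := (rightMul S (-y)).prod (rightMul S x)
  have h₁ : HasFiniteResolution S 1 (ModuleCat.of S (LinearMap.ker ε)) := by
    refine of_exact d₂ d₁ ?_ ?_ ?_ h₀
    · refine (injective_iff_map_eq_zero d₂).2 fun t ht => hx t (congrArg Prod.snd ht)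
    · ext ⟨a, b⟩
      simp only [LinearMap.mem_range, LinearMap.mem_ker, Subtype.ext_iff]
      change (∃ t, (t * (-y), t * x) = (a, b)) ↔ a * x + b * y = 0
      constructor
      · rintro ⟨t, ht⟩
        obtain ⟨rfl, rfl⟩ := Prod.mk.inj ht
        rw [mul_assoc, mul_assoc, hxy.eq, neg_mul, mul_neg, neg_add_cancel]
      · intro h
        -- From `a * x + b * y = 0`, regularity of `y` modulo `T x` gives `b = r * x`. Then `(a + r
        -- * y) * x = 0`, and regularity of `x` forces `a = -(r * y)`.
        obtain ⟨r, rfl⟩ := Submodule.mem_span_singleton.1 (hy b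
          (Submodule.mem_span_singleton.2 ⟨-a, by
            rw [smul_eq_mul, neg_mul]; exact neg_eq_of_add_eq_zero_right h⟩))
        refine ⟨r, Prod.ext ?_ rfl⟩
        rw [smul_eq_mul, mul_assoc, hxy.eq, ← mul_assoc, ← add_mul] at h
        have := hx _ h
        rw [mul_neg]
        exact (eq_neg_of_add_eq_zero_left this).symm
    · rintro ⟨t, ht⟩
      obtain ⟨a, b, rfl⟩ := (hker t).1 ht
      exact ⟨(a, b), rfl⟩
  exact of_exact (LinearMap.ker ε).subtype ε Subtype.val_injective (Submodule.range_subtype _) hε h₁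

end Koszul

/-! ### A regular sequence in the enveloping algebra of the torus -/

namespace NCTorus

variable (θ : ℝ)

/-- The algebra homomorphism out of the noncommutative torus given by two invertible elements
that commute up to `λ`. -/
noncomputable def lift {A : Type*} [Ring A] [Algebra ℂ A] (f : TorusGen → A)
    (h : ∀ x, f x * f x.swap = 1) (hc : f .U * f .V = torusParam θ • (f .V * f .U))
    (hc' : f .Vs * f .Us = star (torusParam θ) • (f .Us * f .Vs)) : NCTorus θ →ₐ[ℂ] A :=
  RingQuot.liftAlgHom ℂ ⟨FreeAlgebra.lift ℂ f, by
    intro a b r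
    cases r <;> simp only [map_smul, map_mul, map_one, FreeAlgebra.lift_ι_apply]
    exacts [h .U, h .Us, h .V, h .Vs, hc, hc']⟩

theorem lift_gen {A : Type*} [Ring A] [Algebra ℂ A] (f : TorusGen → A) (h) (hc) (hc')
    (x : TorusGen) : lift θ f h hc hc' (gen θ x) = f x := by
  refine (RingQuot.liftAlgHom_mkAlgHom_apply ℂ _ _ _).trans ?_
  exact FreeAlgebra.lift_ι_apply _ _

theorem gen_mul_gen_swap (x : TorusGen) : gen θ x * gen θ x.swap = 1 := by
  cases x
  exacts [U_mul_Us θ, Us_mul_U θ, V_mul_Vs θ, Vs_mul_V θ]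

/-- The enveloping algebra of the noncommutative torus. -/
abbrev Env : Type := NCTorus θ ⊗[ℂ] (NCTorus θ)ᵐᵒᵖ

open MulOpposite (op unop)

/-- The grading of the left tensor factor by a weight on the letters, as an algebra homomorphism
to Laurent polynomials. -/
noncomputable def leftCoaction (w : TorusGen → ℤ) (hw : ∀ x, w x.swap = -w x) :
    NCTorus θ →ₐ[ℂ] LaurentPolynomial (Env θ) :=
  lift θ (fun x => (AddMonoidAlgebra.single (w x) (gen θ x ⊗ₜ[ℂ] 1) : LaurentPolynomial (Env θ)))
    (fun x => by
      rw [AddMonoidAlgebra.single_mul_single, hw, add_neg_cancel,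
        Algebra.TensorProduct.tmul_mul_tmul, gen_mul_gen_swap, one_mul]
      rfl)
    (by
      rw [AddMonoidAlgebra.single_mul_single, AddMonoidAlgebra.single_mul_single,
        AddMonoidAlgebra.smul_single, Algebra.TensorProduct.tmul_mul_tmul,
        Algebra.TensorProduct.tmul_mul_tmul, comm, TensorProduct.smul_tmul', add_comm])
    (by
      rw [AddMonoidAlgebra.single_mul_single, AddMonoidAlgebra.single_mul_single,
        AddMonoidAlgebra.smul_single, Algebra.TensorProduct.tmul_mul_tmul,
        Algebra.TensorProduct.tmul_mul_tmul, comm_star, TensorProduct.smul_tmul', add_comm])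

theorem leftCoaction_gen (w : TorusGen → ℤ) (hw : ∀ x, w x.swap = -w x) (x : TorusGen) :
    leftCoaction θ w hw (gen θ x) = .single (w x) (gen θ x ⊗ₜ 1) :=
  lift_gen θ _ _ _ _ x

/-- The grading of the enveloping algebra by a weight on the letters of the left tensor factor. -/
noncomputable def envCoaction (w : TorusGen → ℤ) (hw : ∀ x, w x.swap = -w x) :
    Env θ →ₐ[ℂ] LaurentPolynomial (Env θ) :=
  Algebra.TensorProduct.lift (leftCoaction θ w hw)
    (AddMonoidAlgebra.singleZeroAlgHom.comp Algebra.TensorProduct.includeRight) (by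
      intro s t
      induction s using induction_on with
      | algebraMap c => rw [AlgHom.commutes]; exact Algebra.commutes _ _
      | add a b ha hb => rw [map_add]; exact ha.add_left hb
      | mul a b ha hb => rw [map_mul]; exact ha.mul_left hb
      | gen x =>
        rw [leftCoaction_gen]
        change AddMonoidAlgebra.single _ _ * AddMonoidAlgebra.single 0 (1 ⊗ₜ t) =
          AddMonoidAlgebra.single 0 (1 ⊗ₜ t) * AddMonoidAlgebra.single _ _
        simp [AddMonoidAlgebra.single_mul_single, -LaurentPolynomial.single_eq_C_mul_T])

theorem envCoaction_gen_tmul (w : TorusGen → ℤ) (hw : ∀ x, w x.swap = -w x) (x : TorusGen)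
    (t : (NCTorus θ)ᵐᵒᵖ) :
    envCoaction θ w hw (gen θ x ⊗ₜ t) = .single (w x) (gen θ x ⊗ₜ t) := by
  rw [envCoaction, Algebra.TensorProduct.lift_tmul, leftCoaction_gen]
  change AddMonoidAlgebra.single _ _ * AddMonoidAlgebra.single 0 (1 ⊗ₜ t) = _
  simp [AddMonoidAlgebra.single_mul_single, -LaurentPolynomial.single_eq_C_mul_T]

theorem augmentation_comp_envCoaction (w : TorusGen → ℤ) (hw : ∀ x, w x.swap = -w x) :
    (LaurentPolynomial.augmentation ℂ (Env θ)).comp (envCoaction θ w hw) = AlgHom.id ℂ _ := by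
  refine Algebra.TensorProduct.ext (algHom_ext θ fun x => ?_) (AlgHom.ext fun t => ?_)
  · simp [envCoaction_gen_tmul, LaurentPolynomial.augmentation_single,
      -LaurentPolynomial.single_eq_C_mul_T]
  · change LaurentPolynomial.augmentation ℂ (Env θ) (envCoaction θ w hw (1 ⊗ₜ t)) = 1 ⊗ₜ t
    rw [envCoaction, Algebra.TensorProduct.lift_tmul, map_one, one_mul]
    exact LaurentPolynomial.augmentation_single _ _

/-- `x ⊗ x⁻¹` in the enveloping algebra. -/
noncomputable def conjugator (x : TorusGen) : Env θ := gen θ x ⊗ₜ op (gen θ x.swap)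

/-- Exchanging the left tensor factors produces `λ`, exchanging the right ones produces `λ̄`, and `λ
λ̄ = 1`. -/
theorem commute_conjugator : Commute (conjugator θ .U) (conjugator θ .V) := by
  rw [Commute, SemiconjBy, conjugator, conjugator, Algebra.TensorProduct.tmul_mul_tmul,
    Algebra.TensorProduct.tmul_mul_tmul, ← MulOpposite.op_mul, ← MulOpposite.op_mul]
  simp only [TorusGen.swap]
  rw [comm, comm_star, MulOpposite.op_smul, TensorProduct.smul_tmul_smul, torusParam_mul_star,
    one_smul]

theorem eq_zero_of_mul_conjugator_sub_one (t : Env θ) (ht : t * (conjugator θ .U - 1) = 0) :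
    t = 0 := by
  let w : TorusGen → ℤ
    | .U => 1
    | .Us => -1
    | _ => 0
  have hw : ∀ x, w x.swap = -w x := by rintro (_ | _ | _ | _) <;> rfl
  refine (Submodule.mem_bot (Env θ)).1 (mem_of_mul_sub_mem (envCoaction θ w hw)
    (augmentation_comp_envCoaction θ w hw) (conjugator θ .U)
    (envCoaction_gen_tmul θ w hw _ _) ⊥ ?_ ?_ t ?_)
  · simp
  · simp
  · exact ht

/-- In the grading by degree in `V`, `conjugator θ .U - 1` is homogeneous of degree zero, so the
left ideal it generates is graded. It is stable under right multiplication by `conjugator θ .V`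
because the conjugators commute. -/
theorem mem_span_of_mul_conjugator_sub_one (t : Env θ)
    (ht : t * (conjugator θ .V - 1) ∈ Submodule.span (Env θ) {conjugator θ .U - 1}) :
    t ∈ Submodule.span (Env θ) {conjugator θ .U - 1} := by
  let w : TorusGen → ℤ
    | .V => 1
    | .Vs => -1
    | _ => 0
  have hw : ∀ x, w x.swap = -w x := by rintro (_ | _ | _ | _) <;> rfl
  refine mem_of_mul_sub_mem (envCoaction θ w hw)
    (augmentation_comp_envCoaction θ w hw) (conjugator θ .V)
    (envCoaction_gen_tmul θ w hw _ _) _ ?_ ?_ t ht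
  · intro t ht
    obtain ⟨r, rfl⟩ := Submodule.mem_span_singleton.1 ht
    refine Submodule.mem_span_singleton.2 ⟨r * conjugator θ .V, ?_⟩
    simp only [smul_eq_mul, mul_assoc]
    rw [((commute_conjugator θ).sub_left (Commute.one_left _)).eq]
  · intro t ht n
    obtain ⟨r, rfl⟩ := Submodule.mem_span_singleton.1 ht
    have : envCoaction θ w hw (conjugator θ .U - 1) = .single 0 (conjugator θ .U - 1) := by
      rw [map_sub, map_one, conjugator, envCoaction_gen_tmul, AddMonoidAlgebra.single_sub]
      rfl
    rw [smul_eq_mul, map_mul, this]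
    refine Submodule.mem_span_singleton.2 ⟨(envCoaction θ w hw r).coeff n, ?_⟩
    rw [AddMonoidAlgebra.coeff_mul_single_apply, neg_zero, add_zero, smul_eq_mul]

/-- The kernel of the multiplication map. -/
theorem mulLeftRight_one_eq_zero_iff (t : Env θ) :
    AlgHom.mulLeftRight ℂ (NCTorus θ) t 1 = 0 ↔
      ∃ a b, a * (conjugator θ .U - 1) + b * (conjugator θ .V - 1) = t := by
  let J : Submodule (Env θ) (Env θ) :=
    Submodule.span (Env θ) {conjugator θ .U - 1, conjugator θ .V - 1}
  have hU : conjugator θ .U - 1 ∈ J := Submodule.subset_span (by simp)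
  have hV : conjugator θ .V - 1 ∈ J := Submodule.subset_span (by simp)
  have hJ (r z : Env θ) (hz : z ∈ J) : r * z ∈ J := J.smul_mem r hz
  -- Modulo `J` the right factor can be moved into the left one. Quantifying over `s` lets a product
  -- in `m` be moved one factor at a time. The letters `U*` and `V*` need no further generators of
  -- `J`, only different multipliers.
  have hpure (m : NCTorus θ) : ∀ s : NCTorus θ, (s ⊗ₜ op m - (s * m) ⊗ₜ 1 : Env θ) ∈ J := by
    induction m using induction_on with
    | algebraMap c =>
      intro s
      convert J.zero_mem
      rw [sub_eq_zero, Algebra.algebraMap_eq_smul_one, MulOpposite.op_smul, MulOpposite.op_one,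
        mul_smul_comm, mul_one, TensorProduct.tmul_smul, TensorProduct.smul_tmul']
    | add a b ha hb =>
      intro s
      convert J.add_mem (ha s) (hb s) using 1
      rw [MulOpposite.op_add, TensorProduct.tmul_add, mul_add, TensorProduct.add_tmul]
      abel
    | mul a b ha hb =>
      intro s
      convert J.add_mem (hJ (1 ⊗ₜ op b) _ (ha s)) (hb (s * a)) using 1
      simp [mul_sub, mul_assoc]
    | gen x =>
      intro s
      cases x with
      | U =>
        convert J.neg_mem (hJ (s ⊗ₜ op (gen θ .U)) _ hU) using 1
        simp [mul_sub, conjugator, ← MulOpposite.op_mul, TorusGen.swap, Us_mul_U]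
      | Us =>
        convert hJ ((s * gen θ .Us) ⊗ₜ 1) _ hU using 1
        simp [mul_sub, conjugator, mul_assoc, TorusGen.swap, Us_mul_U]
      | V =>
        convert J.neg_mem (hJ (s ⊗ₜ op (gen θ .V)) _ hV) using 1
        simp [mul_sub, conjugator, ← MulOpposite.op_mul, TorusGen.swap, Vs_mul_V]
      | Vs =>
        convert hJ ((s * gen θ .Vs) ⊗ₜ 1) _ hV using 1
        simp [mul_sub, conjugator, mul_assoc, TorusGen.swap, Vs_mul_V]
  have key : t - AlgHom.mulLeftRight ℂ (NCTorus θ) t 1 ⊗ₜ 1 ∈ J := by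
    induction t using TensorProduct.induction_on with
    | zero => simp
    | add a b ha hb =>
      convert J.add_mem ha hb using 1
      rw [map_add, LinearMap.add_apply, TensorProduct.add_tmul]
      abel
    | tmul s m => simpa using hpure m.unop s
  constructor
  · intro h
    rw [h, TensorProduct.zero_tmul, sub_zero] at key
    obtain ⟨a, b, h⟩ := Submodule.mem_span_pair.1 key
    exact ⟨a, b, h⟩
  · have h (x : TorusGen) : AlgHom.mulLeftRight ℂ (NCTorus θ) (conjugator θ x - 1) 1 = 0 := by
      simp [conjugator, gen_mul_gen_swap]
    rintro ⟨a, b, rfl⟩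
    rw [map_add, map_mul, map_mul, LinearMap.add_apply, Module.End.mul_apply,
      Module.End.mul_apply, h, h, map_zero, map_zero, add_zero]

end NCTorus

/-! ### Strong grading of the torus algebra -/

/-- The only place where irrationality enters: `λ⁴ = 1` would make `4θ` an integer. -/
theorem torusParam_pow_four_ne_one {θ : ℝ} (hθ : Irrational θ) : torusParam θ ^ 4 ≠ 1 := by
  intro h
  rw [torusParam, ← Complex.exp_nat_mul, Complex.exp_eq_one_iff] at h
  obtain ⟨n, hn⟩ := h
  have h₁ : (4 * θ : ℂ) = n := by
    apply mul_left_cancel₀ Complex.two_pi_I_ne_zero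
    rw [mul_comm _ (n : ℂ), ← hn]
    push_cast
    ring
  have h₂ : 4 * θ = n := by exact_mod_cast h₁
  exact (hθ.natCast_mul (m := 4) (by norm_num)).ne_int n (by exact_mod_cast h₂)

theorem torusParam_ne_zero (θ : ℝ) : torusParam θ ≠ 0 := Complex.exp_ne_zero _

theorem star_torusParam (θ : ℝ) : star (torusParam θ) = (torusParam θ)⁻¹ :=
  eq_inv_of_mul_eq_one_right (torusParam_mul_star θ)

namespace NCTorus

variable (θ : ℝ)

theorem flip_gen (x : TorusGen) : flip θ (gen θ x) = gen θ x.swap := flipHom_gen θ x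

theorem flip_flip (a : NCTorus θ) : flip θ (flip θ a) = a :=
  DFunLike.congr_fun (flipHom_comp_self θ) a

theorem mem_flipGrading_zero {a : NCTorus θ} : a ∈ flipGrading θ 0 ↔ flip θ a = a := by
  simp [flipGrading]

theorem mem_flipGrading_one {a : NCTorus θ} : a ∈ flipGrading θ 1 ↔ flip θ a = -a := by
  have : (1 : ZMod 2).val = 1 := rfl
  simp [flipGrading, this]

theorem V_mul_Us : gen θ .V * gen θ .Us = torusParam θ • (gen θ .Us * gen θ .V) := by
  calc gen θ .V * gen θ .Us = gen θ .Us * (gen θ .U * gen θ .V) * gen θ .Us := by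
        rw [← mul_assoc, Us_mul_U, one_mul]
    _ = _ := by
        rw [comm, mul_smul_comm, smul_mul_assoc, mul_assoc, mul_assoc, U_mul_Us, mul_one]

theorem Vs_mul_U : gen θ .Vs * gen θ .U = torusParam θ • (gen θ .U * gen θ .Vs) := by
  calc gen θ .Vs * gen θ .U = gen θ .Vs * (gen θ .U * gen θ .V) * gen θ .Vs := by
        rw [mul_assoc, mul_assoc, V_mul_Vs, mul_one]
    _ = _ := by
        rw [comm, mul_smul_comm, smul_mul_assoc, ← mul_assoc, Vs_mul_V, one_mul]

/-- The unit is a sum of products of two odd elements. -/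
theorem one_mem_flipGrading_one_mul_self (hθ : Irrational θ) :
    (1 : NCTorus θ) ∈ flipGrading θ 1 * flipGrading θ 1 := by
  set u := gen θ .U with hu
  set u' := gen θ .Us with hu'
  set v := gen θ .V with hv
  set v' := gen θ .Vs with hv'
  set l := torusParam θ with hl
  have hl₀ : l ≠ 0 := torusParam_ne_zero θ
  have hl₄ : l ^ 4 ≠ 1 := torusParam_pow_four_ne_one hθ
  have huu : u * u' = 1 := U_mul_Us θ
  have huu' : u' * u = 1 := Us_mul_U θ
  have hvv : v * v' = 1 := V_mul_Vs θ
  have hvv' : v' * v = 1 := Vs_mul_V θ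
  have h₁ : v * u = l⁻¹ • (u * v) := by rw [← star_torusParam]; exact comm_star_swap θ
  have h₂ : v' * u' = l⁻¹ • (u' * v') := by rw [← star_torusParam]; exact comm_star θ
  have h₃ : v * u' = l • (u' * v) := V_mul_Us θ
  have h₄ : v' * u = l • (u * v') := Vs_mul_U θ
  have a₁ (z : NCTorus θ) : v * (u * z) = l⁻¹ • (u * (v * z)) := by
    rw [← mul_assoc, h₁, smul_mul_assoc, mul_assoc]
  have a₂ (z : NCTorus θ) : v' * (u' * z) = l⁻¹ • (u' * (v' * z)) := by
    rw [← mul_assoc, h₂, smul_mul_assoc, mul_assoc]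
  have a₃ (z : NCTorus θ) : v * (u' * z) = l • (u' * (v * z)) := by
    rw [← mul_assoc, h₃, smul_mul_assoc, mul_assoc]
  have a₄ (z : NCTorus θ) : v' * (u * z) = l • (u * (v' * z)) := by
    rw [← mul_assoc, h₄, smul_mul_assoc, mul_assoc]
  have b₁ (z : NCTorus θ) : u * (u' * z) = z := by rw [← mul_assoc, huu, one_mul]
  have b₂ (z : NCTorus θ) : u' * (u * z) = z := by rw [← mul_assoc, huu', one_mul]
  have hs : u - u' ∈ flipGrading θ 1 := by
    simp [mem_flipGrading_one, hu, hu', flip_gen, TorusGen.swap]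
  have hp : u * v - u' * v' ∈ flipGrading θ 1 := by
    simp [mem_flipGrading_one, hu, hu', hv, hv', flip_gen, TorusGen.swap]
  have hr : u * v' - u' * v ∈ flipGrading θ 1 := by
    simp [mem_flipGrading_one, hu, hu', hv, hv', flip_gen, TorusGen.swap]
  have key₁ : (u * v - u' * v') * (u * v' - u' * v) =
      l⁻¹ • (u * u + u' * u') - l • (v * v + v' * v') := by
    simp only [sub_mul, mul_sub, mul_assoc, a₁, a₂, a₃, a₄, hvv, hvv', mul_smul_comm, b₁, b₂,
      mul_one, smul_add]
    abel
  have key₂ : (u * v' - u' * v) * (u * v - u' * v') =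
      l • (u * u + u' * u') - l⁻¹ • (v * v + v' * v') := by
    simp only [sub_mul, mul_sub, mul_assoc, a₁, a₂, a₃, a₄, hvv, hvv', mul_smul_comm, b₁, b₂,
      mul_one, smul_add]
    abel
  have key₃ : (u - u') * (u - u') = (u * u + u' * u') - (2 : ℂ) • 1 := by
    simp only [sub_mul, mul_sub, huu, huu', two_smul]
    abel
  -- This is the coefficient left after eliminating `V² + V*²` from `key₁` and `key₂`. Its vanishing
  -- would mean `λ⁴ = 1`.
  have hc : l⁻¹ * l⁻¹ - l * l ≠ 0 := by
    intro h
    apply hl₄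
    field_simp at h
    linear_combination -h
  -- The combination `λ⁻¹ • key₁ - λ • key₂` isolates `U² + U*²`. Subtracting `(U - U*)²` then
  -- leaves the scalar `2`.
  have key : (1 : NCTorus θ) = (2 : ℂ)⁻¹ • ((l⁻¹ * l⁻¹ - l * l)⁻¹ •
      (l⁻¹ • ((u * v - u' * v') * (u * v' - u' * v)) -
        l • ((u * v' - u' * v) * (u * v - u' * v'))) - (u - u') * (u - u')) := by
    have : l⁻¹ • ((u * v - u' * v') * (u * v' - u' * v)) -
        l • ((u * v' - u' * v) * (u * v - u' * v')) =
        (l⁻¹ * l⁻¹ - l * l) • (u * u + u' * u') := by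
      rw [key₁, key₂, smul_sub, smul_sub, smul_smul, smul_smul, smul_smul, smul_smul, sub_smul,
        mul_comm l⁻¹ l]
      abel
    rw [this, smul_smul, inv_mul_cancel₀ hc, one_smul, key₃, sub_sub_cancel, smul_smul,
      inv_mul_cancel₀ two_ne_zero, one_smul]
  rw [key]
  have hm {a b : NCTorus θ} (ha : a ∈ flipGrading θ 1) (hb : b ∈ flipGrading θ 1) :=
    Submodule.mul_mem_mul ha hb
  refine Submodule.smul_mem _ _ (sub_mem (Submodule.smul_mem _ _ (sub_mem ?_ ?_)) (hm hs hs))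
  · exact Submodule.smul_mem _ _ (hm hp hr)
  · exact Submodule.smul_mem _ _ (hm hr hp)

theorem gradedMonoid_flipGrading : SetLike.GradedMonoid (flipGrading θ) where
  one_mem := (mem_flipGrading_zero θ).2 (map_one _)
  mul_mem i j a b ha hb := by
    have h : ∀ i : ZMod 2, i = 0 ∨ i = 1 := by decide
    obtain rfl | rfl := h i <;> obtain rfl | rfl := h j
    · rw [mem_flipGrading_zero] at ha hb
      refine (mem_flipGrading_zero θ).2 ?_
      rw [map_mul, ha, hb]
    · rw [mem_flipGrading_zero] at ha
      rw [mem_flipGrading_one] at hb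
      refine (mem_flipGrading_one θ).2 ?_
      rw [map_mul, ha, hb, mul_neg]
    · rw [mem_flipGrading_one] at ha
      rw [mem_flipGrading_zero] at hb
      refine (mem_flipGrading_one θ).2 ?_
      rw [map_mul, ha, hb, neg_mul]
    · rw [mem_flipGrading_one] at ha hb
      refine (mem_flipGrading_zero θ).2 ?_
      rw [map_mul, ha, hb, neg_mul_neg]

theorem isInternal_flipGrading : DirectSum.IsInternal (flipGrading θ) := by
  apply DirectSum.isInternal_submodule_of_iSupIndep_of_iSup_eq_top
  · refine (Module.End.eigenspaces_iSupIndep (flip θ).toLinearMap).comp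
      (f := fun i : ZMod 2 => (-1 : ℂ) ^ i.val) ?_
    intro i j h
    fin_cases i <;> fin_cases j <;> first | rfl | (exfalso; revert h; norm_num [ZMod.val])
  · rw [eq_top_iff]
    intro a _
    have h₀ : a + flip θ a ∈ flipGrading θ 0 := by
      rw [mem_flipGrading_zero, map_add, flip_flip, add_comm]
    have h₁ : a - flip θ a ∈ flipGrading θ 1 := by
      rw [mem_flipGrading_one, map_sub, flip_flip, neg_sub]
    have : a = (2 : ℂ)⁻¹ • ((a + flip θ a) + (a - flip θ a)) := by
      rw [add_add_sub_cancel, ← two_smul ℂ, smul_smul, inv_mul_cancel₀ two_ne_zero, one_smul]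
    rw [this]
    exact Submodule.smul_mem _ _ (add_mem (Submodule.mem_iSup_of_mem 0 h₀)
      (Submodule.mem_iSup_of_mem 1 h₁))

theorem isStronglyGraded_flipGrading (hθ : Irrational θ) : IsStronglyGraded (flipGrading θ) where
  gradedMonoid := gradedMonoid_flipGrading θ
  isInternal := isInternal_flipGrading θ
  mul_eq g h := by
    have := gradedMonoid_flipGrading θ
    have hle (i j : ZMod 2) : flipGrading θ i * flipGrading θ j ≤ flipGrading θ (i + j) :=
      Submodule.mul_le.2 fun a ha b hb => SetLike.mul_mem_graded ha hb
    have h₁ : 1 ≤ flipGrading θ 1 * flipGrading θ 1 :=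
      Submodule.one_le.2 (one_mem_flipGrading_one_mul_self θ hθ)
    have h₀ : 1 ≤ flipGrading θ 0 := Submodule.one_le.2 this.one_mem
    refine le_antisymm (hle g h) ?_
    obtain rfl | rfl := (by decide : ∀ g : ZMod 2, g = 0 ∨ g = 1) g
    · calc flipGrading θ (0 + h) = 1 * flipGrading θ h := by rw [zero_add, one_mul]
        _ ≤ _ := mul_le_mul_left h₀ _
    -- Insert `1 ∈ A₁A₁` on the left, absorb the second factor `A₁` into `A_{1+h}`, and use `1 + 1 =
    -- 0`.
    · calc flipGrading θ (1 + h) = 1 * flipGrading θ (1 + h) := by rw [one_mul]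
        _ ≤ flipGrading θ 1 * flipGrading θ 1 * flipGrading θ (1 + h) :=
          mul_le_mul_left h₁ _
        _ = flipGrading θ 1 * (flipGrading θ 1 * flipGrading θ (1 + h)) := mul_assoc _ _ _
        _ ≤ flipGrading θ 1 * flipGrading θ (1 + (1 + h)) := mul_le_mul_right (hle _ _) _
        _ = flipGrading θ 1 * flipGrading θ h := by
          rw [← add_assoc, show (1 + 1 : ZMod 2) = 0 from rfl, zero_add]

end NCTorus

/-! ### Projectivity over the enveloping algebra of a subalgebra -/

theorem Module.finite_and_projective_of_dualBasis {R M ι : Type*} [Ring R] [AddCommGroup M]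
    [Module R M] [Fintype ι] (f : ι → M →ₗ[R] R) (m : ι → M)
    (h : ∀ x, ∑ i, f i x • m i = x) : Module.Finite R M ∧ Module.Projective R M := by
  have hs : Fintype.linearCombination R m ∘ₗ LinearMap.pi f = LinearMap.id := by
    ext x
    simpa [Fintype.linearCombination_apply] using h x
  exact ⟨Module.Finite.of_surjective (Fintype.linearCombination R m)
    fun x => ⟨LinearMap.pi f x, LinearMap.congr_fun hs x⟩, Module.Projective.of_split _ _ hs⟩

namespace Subalgebra

open MulOpposite (op unop)

variable {k A : Type*} [CommRing k] [Ring A] [Algebra k A] (B : Subalgebra k A)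

/-- The map of enveloping algebras induced by the inclusion of a subalgebra. -/
noncomputable def envMap : B ⊗[k] Bᵐᵒᵖ →ₐ[k] A ⊗[k] Aᵐᵒᵖ :=
  Algebra.TensorProduct.map B.val (AlgHom.op B.val)

theorem envMap_tmul (b : B) (c : Bᵐᵒᵖ) : B.envMap (b ⊗ₜ c) = (b : A) ⊗ₜ op (c.unop : A) := rfl

/-- The map of enveloping algebras induced by a linear retraction onto a subalgebra. -/
noncomputable def envRetraction (π : A →ₗ[k] B) : A ⊗[k] Aᵐᵒᵖ →ₗ[k] B ⊗[k] Bᵐᵒᵖ :=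
  TensorProduct.map π ((MulOpposite.opLinearEquiv k).toLinearMap ∘ₗ π ∘ₗ
    (MulOpposite.opLinearEquiv k).symm.toLinearMap)

theorem envRetraction_tmul (π : A →ₗ[k] B) (a : A) (c : Aᵐᵒᵖ) :
    B.envRetraction π (a ⊗ₜ c) = π a ⊗ₜ op (π c.unop) := rfl

/-- Left multiplication in the opposite factor is right multiplication in `A`, so linearity of `π`
on both sides is needed. -/
theorem envRetraction_envMap_mul (π : A →ₗ[k] B) (hl : ∀ (b : B) a, π (b * a) = b * π a)
    (hr : ∀ a (b : B), π (a * b) = π a * b) (s : B ⊗[k] Bᵐᵒᵖ) (t : A ⊗[k] Aᵐᵒᵖ) :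
    B.envRetraction π (B.envMap s * t) = s * B.envRetraction π t := by
  induction s using TensorProduct.induction_on with
  | zero => simp
  | add a b ha hb => rw [map_add, add_mul, map_add, ha, hb, add_mul]
  | tmul b c =>
    induction t using TensorProduct.induction_on with
    | zero => simp
    | add a b ha hb => rw [mul_add, map_add, ha, hb, map_add, mul_add]
    | tmul a d =>
      rw [envMap_tmul, Algebra.TensorProduct.tmul_mul_tmul, envRetraction_tmul,
        envRetraction_tmul, Algebra.TensorProduct.tmul_mul_tmul, hl, MulOpposite.unop_mul,
        MulOpposite.unop_op, hr]
      rfl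

/-- If `A` is finitely generated projective on both sides over `B`, with dual bases built from a
bilinear retraction, then the same holds for the enveloping algebras. -/
theorem env_finite_and_projective (π : A →ₗ[k] B) (hl : ∀ (b : B) a, π (b * a) = b * π a)
    (hr : ∀ a (b : B), π (a * b) = π a * b) {ι : Type*} [Fintype ι] (r s : ι → A)
    (h : ∀ a, ∑ i, (π (a * r i) : A) * s i = a) (h' : ∀ a, ∑ i, r i * (π (s i * a) : A) = a) :
    letI : Module (B ⊗[k] Bᵐᵒᵖ) (A ⊗[k] Aᵐᵒᵖ) := Module.compHom _ B.envMap.toRingHom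
    Module.Finite (B ⊗[k] Bᵐᵒᵖ) (A ⊗[k] Aᵐᵒᵖ) ∧
      Module.Projective (B ⊗[k] Bᵐᵒᵖ) (A ⊗[k] Aᵐᵒᵖ) := by
  let _ : Module (B ⊗[k] Bᵐᵒᵖ) (A ⊗[k] Aᵐᵒᵖ) := Module.compHom _ B.envMap.toRingHom
  have hsmul (x : B ⊗[k] Bᵐᵒᵖ) (t : A ⊗[k] Aᵐᵒᵖ) : x • t = B.envMap x * t := rfl
  let f (p : ι × ι) : A ⊗[k] Aᵐᵒᵖ →ₗ[B ⊗[k] Bᵐᵒᵖ] B ⊗[k] Bᵐᵒᵖ :=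
    { toFun := fun t => B.envRetraction π (t * (r p.1 ⊗ₜ op (s p.2)))
      map_add' := fun a b => by rw [add_mul, map_add]
      map_smul' := fun x t => by
        rw [hsmul, mul_assoc, envRetraction_envMap_mul B π hl hr]
        rfl }
  -- The roles of `r` and `s` are exchanged in the second factor: multiplication is reversed there,
  -- so the identity `h'` is the one that reconstructs `c`.
  refine Module.finite_and_projective_of_dualBasis f
    (fun p : ι × ι => s p.1 ⊗ₜ op (r p.2)) fun t => ?_
  change ∑ p : ι × ι, B.envMap (B.envRetraction π (t * (r p.1 ⊗ₜ op (s p.2)))) *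
    (s p.1 ⊗ₜ op (r p.2)) = t
  induction t using TensorProduct.induction_on with
  | zero => simp
  | add a b ha hb =>
    simp only [add_mul, map_add, Finset.sum_add_distrib]
    rw [ha, hb]
  | tmul a c =>
    have hc : ∑ i, op (π (s i * c.unop) : A) * op (r i) = c := by
      simp only [← MulOpposite.op_mul]
      rw [← Finset.op_sum, h', MulOpposite.op_unop]
    simp only [Algebra.TensorProduct.tmul_mul_tmul, envRetraction_tmul, envMap_tmul]
    rw [Fintype.sum_prod_type]
    conv_rhs => rw [← h a, ← hc, TensorProduct.sum_tmul]
    refine Finset.sum_congr rfl fun i _ => ?_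
    rw [TensorProduct.tmul_sum]
    rfl

end Subalgebra

/-! ### Smoothness of the pillow algebra -/

namespace NCTorus

variable (θ : ℝ)

theorem mem_pillow {a : NCTorus θ} : a ∈ pillow θ ↔ flip θ a = a := Iff.rfl

/-- The projection of the noncommutative torus to the pillow algebra. -/
noncomputable def average : NCTorus θ →ₗ[ℂ] pillow θ :=
  LinearMap.codRestrict (Subalgebra.toSubmodule (pillow θ))
    ((2 : ℂ)⁻¹ • (LinearMap.id + (flip θ).toLinearMap)) fun a => by
      rw [Subalgebra.mem_toSubmodule, mem_pillow]
      simp [flip_flip, add_comm]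

theorem coe_average (a : NCTorus θ) : (average θ a : NCTorus θ) = (2 : ℂ)⁻¹ • (a + flip θ a) := rfl

theorem coe_average_of_mem {a : NCTorus θ} (ha : flip θ a = a) :
    (average θ a : NCTorus θ) = a := by
  rw [coe_average, ha, ← two_smul ℂ, smul_smul, inv_mul_cancel₀ two_ne_zero, one_smul]

theorem average_coe (b : pillow θ) : average θ b = b :=
  Subtype.ext (coe_average_of_mem θ b.2)

theorem average_mul_left (b : pillow θ) (a : NCTorus θ) : average θ (b * a) = b * average θ a := by
  have hb : flip θ b = b := b.2
  ext
  rw [MulMemClass.coe_mul, coe_average, coe_average, map_mul, hb, ← mul_add, mul_smul_comm]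

theorem average_mul_right (a : NCTorus θ) (b : pillow θ) : average θ (a * b) = average θ a * b := by
  have hb : flip θ b = b := b.2
  ext
  rw [MulMemClass.coe_mul, coe_average, coe_average, map_mul, hb, ← add_mul, smul_mul_assoc]

/-- A finite dual basis of the noncommutative torus over the pillow algebra, on both sides. -/
theorem exists_dualBasis (hθ : Irrational θ) : ∃ (n : ℕ) (r s : Option (Fin n) → NCTorus θ),
    (∀ a, ∑ i, (average θ (a * r i) : NCTorus θ) * s i = a) ∧
      ∀ a, ∑ i, r i * (average θ (s i * a) : NCTorus θ) = a := by
  have h := one_mem_flipGrading_one_mul_self θ hθ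
  rw [Submodule.mul_eq_span_mul_set, Submodule.mem_span_set'] at h
  obtain ⟨n, c, g, hg⟩ := h
  choose p hp q hq hpq using fun i => Set.mem_mul.1 (g i).2
  have hp (i) : flip θ (p i) = -p i := (mem_flipGrading_one θ).1 (hp i)
  have hq (i) : flip θ (q i) = -q i := (mem_flipGrading_one θ).1 (hq i)
  have h₁ : ∑ i, c i • p i * q i = 1 := by
    rw [← hg]
    exact Finset.sum_congr rfl fun i _ => by rw [← hpq, smul_mul_assoc]
  -- The index `none` recovers the even part of `a`. The odd part is recovered by inserting `1 = ∑
  -- cᵢ pᵢ qᵢ`, because averaging `a * pᵢ` or `qᵢ * a` with `pᵢ`, `qᵢ` odd keeps only the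
  -- contribution of the odd part of `a`.
  let r : Option (Fin n) → NCTorus θ := fun o => o.elim 1 fun i => c i • p i
  let s : Option (Fin n) → NCTorus θ := fun o => o.elim 1 q
  have hr (i) (a : NCTorus θ) : (average θ (a * (c i • p i)) : NCTorus θ) =
      (2 : ℂ)⁻¹ • (a - flip θ a) * (c i • p i) := by
    rw [coe_average, map_mul, map_smul, hp, smul_neg, mul_neg, ← sub_eq_add_neg, ← sub_mul,
      smul_mul_assoc]
  have hs (i) (a : NCTorus θ) : (average θ (q i * a) : NCTorus θ) =
      q i * (2 : ℂ)⁻¹ • (a - flip θ a) := by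
    rw [coe_average, map_mul, hq, neg_mul, ← sub_eq_add_neg, ← mul_sub, mul_smul_comm]
  have hsplit (a : NCTorus θ) : (average θ a : NCTorus θ) + (2 : ℂ)⁻¹ • (a - flip θ a) = a := by
    rw [coe_average, ← smul_add, add_add_sub_cancel, ← two_smul ℂ, smul_smul,
      inv_mul_cancel₀ two_ne_zero, one_smul]
  refine ⟨n, r, s, fun a => ?_, fun a => ?_⟩
  · rw [Fintype.sum_option]
    simp only [r, s, Option.elim, mul_one, hr, mul_assoc]
    rw [← Finset.mul_sum, h₁, mul_one, hsplit]
  · rw [Fintype.sum_option]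
    simp only [r, s, Option.elim, one_mul, hs, ← mul_assoc]
    rw [← Finset.sum_mul, h₁, one_mul, hsplit]

theorem hasFiniteResolution_pillow (hθ : Irrational θ) :
    HasFiniteResolution (pillow θ ⊗[ℂ] (pillow θ)ᵐᵒᵖ) 2 (bimoduleSelf ℂ (pillow θ)) := by
  obtain ⟨n, r, s, hl, hr⟩ := exists_dualBasis θ hθ
  let _ : Module (pillow θ ⊗[ℂ] (pillow θ)ᵐᵒᵖ) (Env θ) :=
    Module.compHom _ (pillow θ).envMap.toRingHom
  obtain ⟨hfin, hproj⟩ := (pillow θ).env_finite_and_projective (average θ)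
    (average_mul_left θ) (average_mul_right θ) r s hl hr
  have : IsScalarTower (pillow θ ⊗[ℂ] (pillow θ)ᵐᵒᵖ) (Env θ) (Env θ) :=
    ⟨fun x y z => mul_assoc ((pillow θ).envMap x) y z⟩
  let _ : Module (Env θ) (NCTorus θ) := instModuleTensorProductMop ℂ (NCTorus θ)
  let _ : Module (pillow θ ⊗[ℂ] (pillow θ)ᵐᵒᵖ) (NCTorus θ) :=
    Module.compHom _ (pillow θ).envMap.toRingHom
  let _ : Module (pillow θ ⊗[ℂ] (pillow θ)ᵐᵒᵖ) (pillow θ) := instModuleTensorProductMop ℂ (pillow θ)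
  have hsmul (b : pillow θ) (c : (pillow θ)ᵐᵒᵖ) (a : NCTorus θ) :
      (b ⊗ₜ[ℂ] c : pillow θ ⊗[ℂ] (pillow θ)ᵐᵒᵖ) • a = b * a * c.unop :=
    AlgHom.mulLeftRight_apply ℂ (NCTorus θ) b (.op c.unop) a
  have hsmul' (b : pillow θ) (c : (pillow θ)ᵐᵒᵖ) (a : pillow θ) :
      (b ⊗ₜ[ℂ] c : pillow θ ⊗[ℂ] (pillow θ)ᵐᵒᵖ) • a = b * a * c.unop :=
    AlgHom.mulLeftRight_apply ℂ (pillow θ) b c a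
  have hzero (a : NCTorus θ) : (0 : pillow θ ⊗[ℂ] (pillow θ)ᵐᵒᵖ) • a = 0 := Module.zero_smul a
  have hzero' (a : pillow θ) : (0 : pillow θ ⊗[ℂ] (pillow θ)ᵐᵒᵖ) • a = 0 := Module.zero_smul a
  let ε : Env θ →ₗ[pillow θ ⊗[ℂ] (pillow θ)ᵐᵒᵖ] NCTorus θ :=
    { toFun := fun t => AlgHom.mulLeftRight ℂ (NCTorus θ) t 1
      map_add' := fun a b => by rw [map_add, LinearMap.add_apply]
      map_smul' := fun x t => by
        change AlgHom.mulLeftRight ℂ (NCTorus θ) ((pillow θ).envMap x * t) 1 = _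
        rw [map_mul]
        rfl }
  -- The Koszul complex over `Env θ`, restricted along `envMap`: its terms are still finitely
  -- generated projective by `hfin` and `hproj`.
  have hA : HasFiniteResolution (pillow θ ⊗[ℂ] (pillow θ)ᵐᵒᵖ) 2 (ModuleCat.of _ (NCTorus θ)) :=
    HasFiniteResolution.koszul
      (((commute_conjugator θ).sub_left (Commute.one_left _)).sub_right (Commute.one_right _))
      (eq_zero_of_mul_conjugator_sub_one θ)
      (mem_span_of_mul_conjugator_sub_one θ)
      ε (fun a => ⟨a ⊗ₜ 1, by simp [ε]⟩) (mulLeftRight_one_eq_zero_iff θ)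
  let i : pillow θ →ₗ[pillow θ ⊗[ℂ] (pillow θ)ᵐᵒᵖ] NCTorus θ :=
    { toFun := fun b => b
      map_add' := fun _ _ => rfl
      map_smul' := fun x a => by
        induction x using TensorProduct.induction_on with
        | zero => exact (congrArg Subtype.val (hzero' a)).trans (hzero a).symm
        | add x y hx hy =>
          simp only [RingHom.id_apply, add_smul] at *
          rw [← hx, ← hy]
          rfl
        | tmul b c =>
          rw [RingHom.id_apply, hsmul, hsmul']
          rfl }
  -- Averaging is linear over the pillow algebra on both sides and fixes it, so it splits the
  -- inclusion `i` as a map of bimodules.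
  let ρ : NCTorus θ →ₗ[pillow θ ⊗[ℂ] (pillow θ)ᵐᵒᵖ] pillow θ :=
    { toFun := fun a => average θ a
      map_add' := map_add _
      map_smul' := fun x a => by
        induction x using TensorProduct.induction_on with
        | zero =>
          exact ((congrArg (average θ) (hzero a)).trans (map_zero _)).trans (hzero' _).symm
        | add x y hx hy =>
          simp only [RingHom.id_apply, add_smul, map_add] at *
          rw [hx, hy]
        | tmul b c =>
          rw [RingHom.id_apply, hsmul, hsmul', average_mul_right, average_mul_left] }
  exact HasFiniteResolution.of_retract i ρ (average_coe θ) hA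

theorem isHomologicallySmooth_pillow (hθ : Irrational θ) :
    IsHomologicallySmooth ℂ (pillow θ) := by
  obtain ⟨P, h₁, h₂⟩ := (hasFiniteResolution_pillow θ hθ).exists_projectiveResolution
  exact ⟨P, h₁, 2, h₂⟩

end NCTorus

theorem theorem1 (θ : ℝ) (hθ : Irrational θ) :
    IsStronglyGraded (NCTorus.flipGrading θ) ∧ IsHomologicallySmooth ℂ (NCTorus.pillow θ) :=
  ⟨NCTorus.isStronglyGraded_flipGrading θ hθ, NCTorus.isHomologicallySmooth_pillow θ hθ⟩
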